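/- Setting. Let $\mu_1\gg\mu_2\gg\cdots$ be a finite or infinite sequence of compactly supported finite positive measures on $\mathbb C$, let $\mathcal K=\bigoplus_i L^2(\mu_i)$, and let $M_z$ be multiplication by $z$ on $\mathcal K$. For $H=(h_i)_i$ and $G=(g_i)_i$ in $\mathcal K$ put $\langle H(z),G(z)\rangle=\sum_i h_i(z)\overline{g_i(z)}\,\frac{d\mu_i}{d\mu_1}(z)$. Let $\mathcal H\subset\mathcal K$ be a closed $M_z$-invariant subspace such that $\mathcal K$ is the closed linear span of $\{(M_z^*)^kx: x\in\mathcal H,\ k\ge 0\}$, and let $S=M_z|_{\mathcal H}$; thus $S$ is a subnormal operator with minimal normal extension $M_z$. A subnormal operator is called pure if its restriction to a nonzero closed invariant subspace is never normal. Let $N>1$, let $F_1,\dots,F_N\in\mathcal H$, let $\psi:\mathbb C\to\mathbb C$ be smooth with compact support, and let $\mathcal K_n^\psi$ be the closed linear span of $\{\psi^m x: x\in\mathcal H,\ 0\le m\le n\}$. Assume property $(N,\psi)$: (1) $S$ is pure and rationally $N$-cyclic with cyclic vectors $F_1,\dots,F_N$, i.e. $\mathcal H$ is the closure of the set of all $r_1(S)F_1+\dots+r_N(S)F_N$,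 where the $r_i$ are rational functions with poles off $\sigma(S)$, and $\mathcal H$ is not generated in this way by any $N-1$ vectors; (2) $\mathrm{Area}(\sigma(S)\cap\{\bar\partial\psi=0\})=0$, and $M_z|_{\mathcal K_{N-1}^\psi}$ is pure. For a measure $\nu$ and $k\ge 0$ let $\mathcal C_\psi^k\nu(z)=\int\frac{(\psi(w)-\psi(z))^k}{w-z}\,d\nu(w)$. For $G\in(\mathcal K_{N-1}^\psi)^\perp$ let $M^G(z)$ be the $N\times N$ matrix with $(i,j)$ entry $\mathcal C_\psi^{i-1}(\langle F_j,G\rangle\mu_1)(z)$, let $$W^G=\Big\{\lambda:\ \int\frac{|\langle F_i(z),G(z)\rangle|}{|z-\lambda|}\,d\mu_1(z)<\infty,\ 1\le i\le N\Big\},$$ and let $A$ be the set of atoms of $\mu_1$. Define $$E_N^G=\mathrm{Int}(\sigma(S))\cap W^G\cap\{\lambda:\ \det M^G(\lambda)\ne 0\}$$ and, recursively for $k=N-1,N-2,\dots,1$, $$E_k^G=\Big(\bigcup_{J}\ \{\lambda\in\mathrm{Int}(\sigma(S))\setminus A:\ \det M_J^G(\lambda)\ne 0\}\Big)\setminus \mathrm{clos}\big(E_N^G\cup\dots\cup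 E_{k+1}^G\big),$$ where $J$ runs over the subsets of $\{1,\dots,N\}$ with $N-k$ elements and $M_J^G$ is the $k\times k$ submatrix of $M^G$ obtained by eliminating the first $N-k$ rows and the columns with index in $J$. Theorem. If $\{G_j\}_{j\ge1}\subset(\mathcal K_{N-1}^\psi)^\perp$ is dense in $(\mathcal K_{N-1}^\psi)^\perp$, then $$\mathrm{spt}\,\mu_1\subset\mathrm{clos}\Big(\bigcup_{i=1}^N\bigcup_{j=1}^\infty E_i^{G_j}\Big).$$ -/

import Mathlib

open MeasureTheory Polynomial
open scoped ENNReal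

noncomputable section

/-- The measures `μ₁ ≫ μ₂ ≫ ⋯` (here `μ 0, μ 1, …`) of the spectral model of a normal operator:
finite positive compactly supported Borel measures on `ℂ`, each absolutely continuous with respect
to the preceding one. A finite sequence `μ₁, …, μ_m` is a sequence with `μ i = 0` for `i ≥ m`. -/
structure SpectralData where
  μ : ℕ → Measure ℂ
  finite : ∀ i, IsFiniteMeasure (μ i)
  isCompact_support : ∀ i, IsCompact (μ i).support
  ac : ∀ i, μ (i + 1) ≪ μ i

namespace SpectralData

variable (D : SpectralData)

instance (i : ℕ) : IsFiniteMeasure (D.μ i) := D.finite i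

lemma ac_zero (i : ℕ) : D.μ i ≪ D.μ 0 := by
  induction i with
  | zero => exact Measure.AbsolutelyContinuous.rfl
  | succ k ih => exact (D.ac k).trans ih

lemma ae_mem_support (i : ℕ) : ∀ᵐ z ∂(D.μ i), z ∈ (D.μ 0).support :=
  (D.ac_zero i).ae_le Measure.support_mem_ae

/-- The Hilbert space `𝒦 = ⨁ᵢ L²(μᵢ)` (Hilbert sum). -/
abbrev K : Type := lp (fun i => Lp ℂ 2 (D.μ i)) 2

lemma memLp_top {φ : ℂ → ℂ} (hφ : Measurable φ) (C : ℝ)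
    (hC : ∀ z ∈ (D.μ 0).support, ‖φ z‖ ≤ C) (i : ℕ) : MemLp φ ∞ (D.μ i) :=
  memLp_top_of_bound hφ.aestronglyMeasurable C ((D.ae_mem_support i).mono hC)

/-- Multiplication by a bounded measurable function on `L²(μᵢ)`. -/
def mulCoord (φ : ℂ → ℂ) (hφ : Measurable φ) (C : ℝ)
    (hC : ∀ z ∈ (D.μ 0).support, ‖φ z‖ ≤ C) (i : ℕ) : Lp ℂ 2 (D.μ i) →L[ℂ] Lp ℂ 2 (D.μ i) :=
  (ContinuousLinearMap.mul ℂ ℂ).holderL (D.μ i) ∞ 2 2 ((D.memLp_top hφ C hC i).toLp φ)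

lemma norm_mulCoord_le (φ : ℂ → ℂ) (hφ : Measurable φ) (C : ℝ)
    (hC : ∀ z ∈ (D.μ 0).support, ‖φ z‖ ≤ C) (i : ℕ) :
    ‖D.mulCoord φ hφ C hC i‖ ≤ max C 0 := by
  refine (ContinuousLinearMap.le_opNorm _ _).trans ?_
  have h1 : ‖(ContinuousLinearMap.mul ℂ ℂ).holderL (D.μ i) ∞ 2 2‖ ≤ 1 :=
    (ContinuousLinearMap.norm_holderL_le _).trans (by simp)
  have h2 : ‖(D.memLp_top hφ C hC i).toLp φ‖ ≤ max C 0 := by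
    rw [Lp.norm_toLp]
    refine ENNReal.toReal_le_of_le_ofReal (le_max_right _ _) ?_
    rw [eLpNorm_exponent_top]
    refine eLpNormEssSup_le_of_ae_bound ?_
    filter_upwards [D.ae_mem_support i] with z hz
    exact (hC z hz).trans (le_max_left _ _)
  calc _ ≤ 1 * max C 0 := mul_le_mul h1 h2 (norm_nonneg _) zero_le_one
    _ = _ := one_mul _

/-- Multiplication on `𝒦` by a measurable function that is bounded on `spt μ₁`. -/
def mul (φ : ℂ → ℂ) (hφ : Measurable φ) (C : ℝ)
    (hC : ∀ z ∈ (D.μ 0).support, ‖φ z‖ ≤ C) : D.K →L[ℂ] D.K :=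
  lp.mapCLM 2 (D.mulCoord φ hφ C hC) (le_max_right C 0) (D.norm_mulCoord_le φ hφ C hC)

lemma mul_coe (φ : ℂ → ℂ) (hφ : Measurable φ) (C : ℝ)
    (hC : ∀ z ∈ (D.μ 0).support, ‖φ z‖ ≤ C) (x : D.K) (i : ℕ) :
    (D.mul φ hφ C hC x i : ℂ → ℂ) =ᵐ[D.μ i] fun z => φ z * (x i : ℂ → ℂ) z := by
  have h := (ContinuousLinearMap.mul ℂ ℂ).coeFn_holder (r := 2)
    ((D.memLp_top hφ C hC i).toLp φ) (x i)
  filter_upwards [h, (D.memLp_top hφ C hC i).coeFn_toLp] with z h1 h2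
  rw [← h2]
  exact h1

lemma exists_bound : ∃ C : ℝ, ∀ z ∈ (D.μ 0).support, ‖z‖ ≤ C :=
  (D.isCompact_support 0).isBounded.exists_norm_le

/-- The normal operator `M_z` of multiplication by `z` on `𝒦`. -/
def Mz : D.K →L[ℂ] D.K :=
  D.mul (fun z => z) measurable_id D.exists_bound.choose D.exists_bound.choose_spec

lemma Mz_coe (x : D.K) (i : ℕ) :
    (D.Mz x i : ℂ → ℂ) =ᵐ[D.μ i] fun z => z * (x i : ℂ → ℂ) z :=
  D.mul_coe _ _ _ _ x i

/-- The pointwise pairing `⟨X(z), Y(z)⟩ = ∑ᵢ xᵢ(z) conj(yᵢ(z)) (dμᵢ/dμ₁)(z)`. -/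
def pairing (X Y : D.K) (z : ℂ) : ℂ :=
  ∑' i, (X i : ℂ → ℂ) z * starRingEnd ℂ ((Y i : ℂ → ℂ) z) * (((D.μ i).rnDeriv (D.μ 0) z).toReal : ℂ)

end SpectralData

/-- The restriction of `T` to the closed subspace `L` is pure: its restriction to a nonzero closed
invariant subspace is never normal. -/
def IsPureOn {E : Type*} [NormedAddCommGroup E] [InnerProductSpace ℂ E]
    (T : E →L[ℂ] E) (L : Submodule ℂ E) : Prop :=
  ∀ (I : Submodule ℂ E) [CompleteSpace I] (hI : ∀ x ∈ I, T x ∈ I),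
    I ≤ L → I ≠ ⊥ → ¬ IsStarNormal (T.restrict hI : I →L[ℂ] I)

/-- `R²(S | F₁, …, F_n)`: the closure of the set of all `r₁(S)F₁ + ⋯ + r_n(S)F_n`, where
`rᵢ = pᵢ / qᵢ` are rational functions with poles off `σ(S)`; here `r(S) = p(S) q(S)⁻¹`. -/
def ratClosure {E : Type*} [NormedAddCommGroup E] [InnerProductSpace ℂ E]
    (S : E →L[ℂ] E) {n : ℕ} (F : Fin n → E) : Set E :=
  closure {x | ∃ p q : Fin n → ℂ[X], (∀ i, ∀ z ∈ spectrum ℂ S, (q i).eval z ≠ 0) ∧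
    x = ∑ i, (aeval S (p i) * Ring.inverse (aeval S (q i))) (F i)}

/-- `S` is rationally `N`-cyclic with cyclic vectors `F₁, …, F_N`: these generate the space, and no
`N - 1` vectors do. -/
def IsRationallyCyclic {E : Type*} [NormedAddCommGroup E] [InnerProductSpace ℂ E]
    (S : E →L[ℂ] E) {N : ℕ} (F : Fin N → E) : Prop :=
  ratClosure S F = Set.univ ∧ ∀ G : Fin (N - 1) → E, ratClosure S G ≠ Set.univ

/-- A subnormal operator in its functional model: a closed `M_z`-invariant subspace `ℋ` of
`𝒦 = ⨁ᵢ L²(μᵢ)` such that `M_z` is the minimal normal extension of `S = M_z|ℋ`. -/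
structure SubnormalModel extends SpectralData where
  H : Submodule ℂ toSpectralData.K
  isClosed_H : IsClosed (H : Set toSpectralData.K)
  invariant : ∀ x ∈ H, toSpectralData.Mz x ∈ H
  minimal : (Submodule.span ℂ {y | ∃ x ∈ H, ∃ k : ℕ,
    y = ((ContinuousLinearMap.adjoint toSpectralData.Mz) ^ k) x}).topologicalClosure = ⊤

/-- The Wirtinger derivative `∂̄ψ = (∂ₓψ + i ∂_yψ) / 2`. -/
def dbar (ψ : ℂ → ℂ) (z : ℂ) : ℂ :=
  (fderiv ℝ ψ z 1 + Complex.I * fderiv ℝ ψ z Complex.I) / 2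

/-- The generalized Cauchy transform
`𝒞_ψ^k(f μ)(z) = ∫ (ψ(w) - ψ(z))^k / (w - z) f(w) dμ(w)`. -/
def genCauchy (ψ : ℂ → ℂ) (k : ℕ) (μ : Measure ℂ) (f : ℂ → ℂ) (z : ℂ) : ℂ :=
  ∫ w, (ψ w - ψ z) ^ k / (w - z) * f w ∂μ

namespace SubnormalModel

variable (T : SubnormalModel)

/-- The subnormal operator `S = M_z|ℋ`. -/
def S : T.H →L[ℂ] T.H := T.Mz.restrict T.invariant

/-- `𝒦_n^ψ`, the closed linear span of the vectors `ψ^m x` with `x ∈ ℋ` and `0 ≤ m ≤ n`. -/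
def Kpsi (ψ : ℂ → ℂ) (n : ℕ) : Submodule ℂ T.K :=
  (Submodule.span ℂ {y : T.K | ∃ x ∈ T.H, ∃ m ≤ n,
    ∀ i, (y i : ℂ → ℂ) =ᵐ[T.μ i] fun z => ψ z ^ m * (x i : ℂ → ℂ) z}).topologicalClosure

/-- Property `(N, ψ)`, with rationally cyclic vectors `F₁, …, F_N`. -/
structure HasProperty (N : ℕ) (ψ : ℂ → ℂ) (F : Fin N → T.H) : Prop where
  pure : IsPureOn T.Mz T.H
  cyclic : IsRationallyCyclic T.S F
  smooth : ContDiff ℝ (⊤ : ℕ∞) ψ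
  compactSupport : HasCompactSupport ψ
  area : volume (spectrum ℂ T.S ∩ {z | dbar ψ z = 0}) = 0
  pure_Kpsi : IsPureOn T.Mz (T.Kpsi ψ (N - 1))

variable {N : ℕ} (ψ : ℂ → ℂ) (F : Fin N → T.H) (G : T.K)

/-- The `N × N` matrix `M^G(z)`, whose row `i = 0, …, N - 1` has the entries
`𝒞_ψ^i(⟨F_j, G⟩ μ₁)(z)`. -/
def cauchyMatrix (z : ℂ) : Matrix (Fin N) (Fin N) ℂ :=
  Matrix.of fun i j => genCauchy ψ i (T.μ 0) (T.pairing (F j) G) z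

/-- `W^G`: the points `z` with `∫ |w - z|⁻¹ |⟨F_i(w), G(w)⟩| dμ₁(w) < ∞` for all `i`
(where `0⁻¹ = ∞`). -/
def W : Set ℂ :=
  {z | ∀ i, ∫⁻ w, ‖w - z‖ₑ⁻¹ * ‖T.pairing (F i) G w‖ₑ ∂(T.μ 0) < ∞}

/-- `Ω^G`. -/
def Omega : Set ℂ :=
  interior (spectrum ℂ T.S) ∩ T.W F G ∩ {z | (T.cauchyMatrix ψ F G z).det ≠ 0}

/-- The points `z` of `Int σ(S)`, not atoms of `μ₁`, at which `det ≠ 0` for the submatrix of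
`M^G(z)` obtained by eliminating the first `d` rows and retaining the columns
`c 0 < ⋯ < c (N - d - 1)`, that is, eliminating the other `d` columns. -/
def minorSet (d : ℕ) (c : Fin (N - d) ↪o Fin N) : Set ℂ :=
  {z | z ∈ interior (spectrum ℂ T.S) ∧ T.μ 0 {z} = 0 ∧
    ((T.cauchyMatrix ψ F G z).submatrix
      (fun i : Fin (N - d) => (⟨d + i, by omega⟩ : Fin N)) c).det ≠ 0}

/-- `E_{N-d}^G`, by recursion on the number `d` of eliminated rows and columns: `E_N^G = Ω^G`, and
`E_{N-d}^G` is the union, over all choices of `d` eliminated columns, of the sets `minorSet` with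
the closure of `E_N^G ∪ ⋯ ∪ E_{N-d+1}^G` removed. -/
def Eaux (d : ℕ) : Set ℂ :=
  if d = 0 then T.Omega ψ F G
  else (⋃ c : Fin (N - d) ↪o Fin N, T.minorSet ψ F G d c) \
    closure (⋃ e : Fin d, Eaux e)
termination_by d
decreasing_by exact e.isLt

/-- The set `E_k^G`, for `1 ≤ k ≤ N`. -/
def E (k : ℕ) : Set ℂ := T.Eaux ψ F G (N - k)

end SubnormalModel

end

/-! Let `B` be the complement of the closure on the right-hand side; the claim reduces to μ₁(B) = 0.
A nonzero entry in the last row of `M^G` is a nonzero 1 × 1 minor, so at a non-atom of Int σ(S) it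
puts the point in E₁ or in the closure of the other E_k (`mem_closure_iUnion_E`). Hence the
transforms of order N - 1 of ⟨F_i, G_j⟩μ₁ vanish at the non-atoms of B in Int σ(S). Since N > 1, the
kernel of order N - 1 is bounded, so density of the G_j extends this to every G orthogonal to
`Kpsi`. Outside Int σ(S) the transforms vanish anyway: the resolvent of S absorbs the Cauchy kernel,
and continuity covers the boundary.

In the weak sense ∂̄𝒞^{k+1}ν = -(k+1) ∂̄ψ 𝒞^kν and ∂̄𝒞^0ν = -πν. As ∂̄ψ ≠ 0 a.e. on σ(S), the
vanishing descends from order N - 1 to order 0, and then ⟨F_i, G⟩ = 0 μ₁-a.e. on B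
(`ae_pairing_eq_zero`).

Rational cyclicity then shows that multiplication by bounded functions supported in B preserves
`Kpsi`. The part of `Kpsi` living on B reduces M_z, so purity makes it zero; thus ℋ vanishes on B,
and minimality of the normal extension gives μ₁(B) = 0 (`measure_eq_zero_of_pairing_eq_zero`). The
higher minors enter only through the closures removed in the definition of E₁. -/

noncomputable section

/-! ### The Cauchy–Pompeiu formula -/

open Set in
lemma integrableOn_polarCoord_target {A : ℝ × ℝ → ℂ} (hA : Continuous A) {R : ℝ}
    (hR : ∀ p : ℝ × ℝ, 0 < p.1 → R < p.1 → A p = 0) :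
    IntegrableOn A (Ioi 0 ×ˢ Ioo (-Real.pi) Real.pi) := by
  have h1 : IntegrableOn A (Icc 0 R ×ˢ Icc (-Real.pi) Real.pi) :=
    hA.continuousOn.integrableOn_compact (isCompact_Icc.prod isCompact_Icc)
  refine h1.of_forall_sdiff_eq_zero (measurableSet_Ioi.prod measurableSet_Ioo) ?_
  rintro ⟨r, θ⟩ ⟨⟨hr, hθ⟩, h⟩
  refine hR _ hr ?_
  by_contra hlt
  exact h ⟨⟨le_of_lt hr, not_lt.1 hlt⟩, ⟨hθ.1.le, hθ.2.le⟩⟩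

/-- This is e^{-iθ}∂̄ = ½(∂_r + (i/r)∂_θ): the two directions are the unit radial and tangential
vectors. -/
lemma fderiv_I_smul_decomp (D : ℂ →L[ℝ] ℂ) (a b : ℝ) (hab : a ^ 2 + b ^ 2 = 1) :
    (D 1 + Complex.I * D Complex.I) / 2 / (a + b * Complex.I) =
      1 / 2 * D (a + b * Complex.I) + Complex.I / 2 * D (-b + a * Complex.I) := by
  have h1 : D (a + b * Complex.I) = a * D 1 + b * D Complex.I := by
    have : (a + b * Complex.I : ℂ) = a • (1 : ℂ) + b • Complex.I := by simp
    rw [this, map_add, map_smul, map_smul]; simp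
  have h2 : D (-b + a * Complex.I) = -b * D 1 + a * D Complex.I := by
    have : (-b + a * Complex.I : ℂ) = (-b) • (1 : ℂ) + a • Complex.I := by simp
    rw [this, map_add, map_smul, map_smul]; simp
  have h3 : (a + b * Complex.I : ℂ) * (a - b * Complex.I) = 1 := by
    have : (a : ℂ) ^ 2 + (b : ℂ) ^ 2 = 1 := by exact_mod_cast hab
    linear_combination this - (b : ℂ) ^ 2 * Complex.I_sq
  have h4 : (a + b * Complex.I : ℂ) ≠ 0 := left_ne_zero_of_mul_eq_one h3
  rw [h1, h2, div_eq_iff h4]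
  linear_combination (-(D 1 + Complex.I * D Complex.I) / 2) * h3 +
    (-(a * b * D Complex.I) / 2 - Complex.I * b ^ 2 * D Complex.I / 2) * Complex.I_sq

-- In polar coordinates the Jacobian r cancels the pole. The radial part integrates to -h(0)/2 along
-- each ray, and the angular part integrates to zero over each circle by periodicity.
open Set in
lemma integral_dbar_div_self {h : ℂ → ℂ} (hh : ContDiff ℝ 1 h) (hc : HasCompactSupport h) :
    ∫ z, dbar h z / z = -(Real.pi * h 0) := by
  obtain ⟨R, hR⟩ := hc.isCompact.isBounded.exists_norm_le
  set u : ℝ → ℂ := fun θ => Real.cos θ + Real.sin θ * Complex.I with hu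
  set v : ℝ → ℂ := fun θ => -Real.sin θ + Real.cos θ * Complex.I with hv
  have hucont : Continuous u := by fun_prop
  have hvcont : Continuous v := by fun_prop
  have hun : ∀ θ, ‖u θ‖ = 1 := fun θ => by
    simp only [hu]; rw [Complex.norm_add_mul_I]; simp
  have hnorm : ∀ (r θ : ℝ), 0 ≤ r → ‖(r : ℂ) * u θ‖ = r := fun r θ hr => by
    rw [norm_mul, hun, mul_one, Complex.norm_real, Real.norm_of_nonneg hr]
  have hfd : Continuous (fderiv ℝ h) := hh.continuous_fderiv one_ne_zero
  have hz : ∀ z, R < ‖z‖ → h z = 0 := fun z hz => by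
    by_contra hne
    exact absurd (hR z (subset_tsupport _ hne)) (not_le.2 hz)
  have hfz : ∀ z, R < ‖z‖ → fderiv ℝ h z = 0 := fun z hz => by
    by_contra hne
    exact absurd (hR z (support_fderiv_subset ℝ hne)) (not_le.2 hz)
  set A : ℝ × ℝ → ℂ := fun p => 1 / 2 * fderiv ℝ h (p.1 * u p.2) (u p.2) with hA
  set B : ℝ × ℝ → ℂ := fun p => Complex.I / 2 * fderiv ℝ h (p.1 * u p.2) (v p.2) with hB
  have hpt : Continuous fun p : ℝ × ℝ => (p.1 : ℂ) * u p.2 := by fun_prop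
  have hAc : Continuous A :=
    continuous_const.mul ((hfd.comp hpt).clm_apply (hucont.comp continuous_snd))
  have hBc : Continuous B :=
    continuous_const.mul ((hfd.comp hpt).clm_apply (hvcont.comp continuous_snd))
  have hAi : IntegrableOn A (Ioi 0 ×ˢ Ioo (-Real.pi) Real.pi) :=
    integrableOn_polarCoord_target (R := R) hAc fun p h0 h1 => by
      simp only [hA]; rw [hfz _ (by rwa [hnorm _ _ h0.le])]; simp
  have hBi : IntegrableOn B (Ioi 0 ×ˢ Ioo (-Real.pi) Real.pi) :=
    integrableOn_polarCoord_target (R := R) hBc fun p h0 h1 => by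
      simp only [hB]; rw [hfz _ (by rwa [hnorm _ _ h0.le])]; simp
  have hdu : ∀ θ, HasDerivAt u (v θ) θ := fun θ => by
    have h1 : HasDerivAt (fun θ : ℝ => ((Real.cos θ : ℝ) : ℂ)) (-Real.sin θ : ℝ) θ :=
      (Real.hasDerivAt_cos θ).ofReal_comp
    have h2 : HasDerivAt (fun θ : ℝ => ((Real.sin θ : ℝ) : ℂ)) (Real.cos θ : ℝ) θ :=
      (Real.hasDerivAt_sin θ).ofReal_comp
    have := h1.add (h2.mul_const Complex.I)
    simp only [hv]
    convert! this using 1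
    push_cast; ring
  have hhd : ∀ z, HasFDerivAt h (fderiv ℝ h z) z := fun z =>
    (hh.differentiable one_ne_zero z).hasFDerivAt
  have hBint : ∫ p in Ioi 0 ×ˢ Ioo (-Real.pi) Real.pi, B p = 0 := by
    rw [Measure.volume_eq_prod] at hBi ⊢
    rw [setIntegral_prod _ hBi]
    refine setIntegral_eq_zero_of_forall_eq_zero fun r hr => ?_
    have hr' : (r : ℂ) ≠ 0 := by exact_mod_cast (ne_of_gt hr)
    have hd : ∀ θ ∈ uIcc (-Real.pi) Real.pi,
        HasDerivAt (fun θ => Complex.I / 2 / r * h (r * u θ)) (B (r, θ)) θ := fun θ _ => by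
      have h1 := (hhd (r * u θ)).comp_hasDerivAt θ ((hdu θ).const_mul (r : ℂ))
      have h2 : fderiv ℝ h (r * u θ) (r * v θ) = r * fderiv ℝ h (r * u θ) (v θ) := by
        have : (r : ℂ) * v θ = r • v θ := by simp
        rw [this, map_smul]; simp
      rw [h2] at h1
      convert! h1.const_mul (Complex.I / 2 / r) using 1
      simp only [hB]; field_simp
    have := intervalIntegral.integral_eq_sub_of_hasDerivAt hd
      ((hBc.comp (Continuous.prodMk_right r)).intervalIntegrable _ _)
    rw [intervalIntegral.integral_of_le (by linarith [Real.pi_pos]),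
      integral_Ioc_eq_integral_Ioo] at this
    rw [this]
    simp [hu]
  have hAint : ∫ p in Ioi 0 ×ˢ Ioo (-Real.pi) Real.pi, A p = -(Real.pi * h 0) := by
    rw [Measure.volume_eq_prod] at hAi ⊢
    rw [setIntegral_prod _ hAi, integral_integral_swap
      (by rw [Measure.prod_restrict]; exact hAi)]
    have : ∀ θ, ∫ r in Ioi (0 : ℝ), A (r, θ) = -(1 / 2 * h 0) := fun θ => by
      have hd : ∀ r : ℝ, HasDerivAt (fun r : ℝ => 1 / 2 * h (r * u θ)) (A (r, θ)) r := fun r => by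
        have h0 : HasDerivAt (fun r : ℝ => (r : ℂ) * u θ) (1 * u θ) r :=
          Complex.ofRealCLM.hasDerivAt.mul_const (u θ)
        rw [one_mul] at h0
        exact ((hhd (r * u θ)).comp_hasDerivAt r h0).const_mul (1 / 2 : ℂ)
      have hcd : ContDiff ℝ 1 (fun r : ℝ => 1 / 2 * h (r * u θ)) := by
        refine contDiff_const.mul (hh.comp ?_)
        exact (Complex.ofRealCLM.contDiff).mul contDiff_const
      have hcs : HasCompactSupport (fun r : ℝ => 1 / 2 * h (r * u θ)) := by
        refine HasCompactSupport.intro (isCompact_Icc (a := -R) (b := R)) fun r hr => ?_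
        rw [hz, mul_zero]
        rw [norm_mul, hun, mul_one, Complex.norm_real, Real.norm_eq_abs]
        by_contra hlt
        exact hr (abs_le.1 (not_lt.1 hlt))
      have := hcs.integral_Ioi_deriv_eq hcd 0
      simp_rw [fun r => (hd r).deriv] at this
      rw [this]; simp
    simp_rw [this]
    rw [setIntegral_const]
    simp [Real.pi_pos.le]
    ring
  rw [← Complex.integral_comp_polarCoord_symm]
  have hcongr : ∀ p ∈ Ioi (0 : ℝ) ×ˢ Ioo (-Real.pi) Real.pi,
      p.1 • (dbar h (Complex.polarCoord.symm p) / Complex.polarCoord.symm p) = A p + B p := by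
    rintro ⟨r, θ⟩ ⟨hr, -⟩
    have hr' : (r : ℂ) ≠ 0 := by exact_mod_cast (ne_of_gt hr)
    have key := fderiv_I_smul_decomp (fderiv ℝ h (r * u θ)) (Real.cos θ) (Real.sin θ)
      (Real.cos_sq_add_sin_sq θ)
    have h1 : A (r, θ) + B (r, θ) = dbar h (r * u θ) / u θ := key.symm
    rw [h1, Complex.polarCoord_symm_apply]
    change r • (dbar h (r * u θ) / (r * u θ)) = _
    rw [Complex.real_smul]
    field_simp
  rw [show polarCoord.target = Ioi (0 : ℝ) ×ˢ Ioo (-Real.pi) Real.pi from rfl,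
    setIntegral_congr_fun (measurableSet_Ioi.prod measurableSet_Ioo) hcongr,
    integral_add hAi hBi, hAint, hBint, add_zero]

lemma dbar_comp_add_const (h : ℂ → ℂ) (w z : ℂ) : dbar (fun z => h (z + w)) z = dbar h (z + w) := by
  simp only [dbar, fderiv_comp_add_right]

/-- The Cauchy–Pompeiu formula for compactly supported functions. -/
lemma integral_dbar_div_sub {h : ℂ → ℂ} (hh : ContDiff ℝ 1 h) (hc : HasCompactSupport h) (w : ℂ) :
    ∫ z, dbar h z / (w - z) = Real.pi * h w := by
  have h1 := integral_dbar_div_self (h := fun z => h (z + w)) (hh.comp (by fun_prop))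
    (hc.comp_homeomorph (Homeomorph.addRight w))
  simp_rw [dbar_comp_add_const] at h1
  have h2 := integral_add_right_eq_self (μ := (volume : Measure ℂ)) (fun z => dbar h z / (w - z)) w
  rw [← h2]
  have : ∀ z : ℂ, dbar h (z + w) / (w - (z + w)) = -(dbar h (z + w) / z) := fun z => by
    rw [← div_neg]; congr 1; ring
  simp_rw [this, integral_neg, h1]
  simp

/-! ### Integrability of the Cauchy kernel in the plane -/

open Set in
lemma lintegral_closedBall_inv_enorm_lt_top :
    ∫⁻ z in Metric.closedBall (0 : ℂ) 1, ‖z‖ₑ⁻¹ < ∞ := by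
  rw [← lintegral_indicator Metric.isClosed_closedBall.measurableSet,
    ← Complex.lintegral_comp_polarCoord_symm]
  have hle : ∀ p ∈ polarCoord.target, ENNReal.ofReal p.1 •
      (Metric.closedBall (0 : ℂ) 1).indicator (fun z => ‖z‖ₑ⁻¹) (Complex.polarCoord.symm p) ≤
      (Ioc (0 : ℝ) 1 ×ˢ Ioo (-Real.pi) Real.pi).indicator (fun _ => 1) p := by
    intro p hp
    have hp1 : 0 < p.1 := hp.1
    have hn : ‖Complex.polarCoord.symm p‖ = p.1 := by
      rw [Complex.norm_polarCoord_symm, abs_of_pos hp1]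
    by_cases h : p.1 ≤ 1
    · rw [indicator_of_mem (show p ∈ Ioc (0 : ℝ) 1 ×ˢ Ioo (-Real.pi) Real.pi from
        ⟨⟨hp1, h⟩, hp.2⟩), indicator_of_mem (by simpa [hn, abs_of_pos hp1] using h),
        ← ofReal_norm, hn, smul_eq_mul]
      exact ENNReal.mul_inv_le_one _
    · rw [indicator_of_notMem (s := Metric.closedBall (0 : ℂ) 1)
        (by rw [mem_closedBall_zero_iff, hn]; exact h)]
      simp
  refine (setLIntegral_mono' polarCoord.open_target.measurableSet hle).trans_lt ?_
  refine (setLIntegral_le_lintegral _ _).trans_lt ?_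
  rw [lintegral_indicator (measurableSet_Ioc.prod measurableSet_Ioo), setLIntegral_const, one_mul,
    Measure.volume_eq_prod, Measure.prod_prod]
  simp

/-- The bound is uniform in w: at distance more than 1 from w the kernel is at most 1, and the rest
is a translate of one fixed integral. -/
lemma exists_lintegral_closedBall_inv_enorm_sub_le (R : ℝ) :
    ∃ L : ℝ≥0∞, L ≠ ∞ ∧ ∀ w : ℂ, ∫⁻ z in Metric.closedBall (0 : ℂ) R, ‖w - z‖ₑ⁻¹ ≤ L := by
  refine ⟨volume (Metric.closedBall (0 : ℂ) R) +
    ∫⁻ z in Metric.closedBall (0 : ℂ) 1, ‖z‖ₑ⁻¹, ?_, fun w => ?_⟩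
  · exact (ENNReal.add_lt_top.2 ⟨measure_closedBall_lt_top,
      lintegral_closedBall_inv_enorm_lt_top⟩).ne
  have hle : ∀ z : ℂ, ‖w - z‖ₑ⁻¹ ≤ 1 +
      (Metric.closedBall (0 : ℂ) 1).indicator (fun z => ‖z‖ₑ⁻¹) (w - z) := fun z => by
    by_cases h : w - z ∈ Metric.closedBall (0 : ℂ) 1
    · rw [Set.indicator_of_mem h]; exact le_add_self
    · rw [Set.indicator_of_notMem h, add_zero, ENNReal.inv_le_one, ← ofReal_norm,
        ENNReal.one_le_ofReal]
      rw [mem_closedBall_zero_iff] at h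
      exact (not_le.1 h).le
  calc _ ≤ ∫⁻ z in Metric.closedBall (0 : ℂ) R, (1 +
        (Metric.closedBall (0 : ℂ) 1).indicator (fun z => ‖z‖ₑ⁻¹) (w - z)) := lintegral_mono hle
    _ = volume (Metric.closedBall (0 : ℂ) R) + ∫⁻ z in Metric.closedBall (0 : ℂ) R,
        (Metric.closedBall (0 : ℂ) 1).indicator (fun z => ‖z‖ₑ⁻¹) (w - z) := by
      rw [lintegral_add_left measurable_const]; simp
    _ ≤ _ := by
      refine add_le_add le_rfl ((setLIntegral_le_lintegral _ _).trans ?_)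
      rw [lintegral_sub_left_eq_self
        (fun z => (Metric.closedBall (0 : ℂ) 1).indicator (fun z => ‖z‖ₑ⁻¹) z),
        lintegral_indicator Metric.isClosed_closedBall.measurableSet]

/-! ### The operator ∂̄ on test functions -/

lemma continuous_dbar {g : ℂ → ℂ} (hg : ContDiff ℝ 1 g) : Continuous (dbar g) := by
  have := hg.continuous_fderiv one_ne_zero
  unfold dbar
  fun_prop

lemma support_dbar_subset (g : ℂ → ℂ) : Function.support (dbar g) ⊆ tsupport g := by
  intro z hz
  by_contra h
  have : fderiv ℝ g z = 0 := by
    by_contra hne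
    exact h (support_fderiv_subset ℝ hne)
  exact hz (by simp [dbar, this])

lemma hasCompactSupport_dbar {g : ℂ → ℂ} (hc : HasCompactSupport g) :
    HasCompactSupport (dbar g) :=
  hc.mono' (support_dbar_subset g)

/-- Vanishing on an open set is tested against real smooth functions. The support of ∂̄g stays
inside that of g, so only values of Φ on U matter. -/
lemma integral_dbar_ofReal_mul_eq_zero {g : ℂ → ℝ} (hg : ContDiff ℝ (⊤ : ℕ∞) g)
    (hgc : HasCompactSupport g) {U : Set ℂ} (hgU : tsupport g ⊆ U) {Φ : ℂ → ℂ}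
    (h : ∀ᵐ z, z ∈ U → Φ z = 0) :
    ContDiff ℝ 1 (fun z => (g z : ℂ)) ∧ HasCompactSupport (fun z => (g z : ℂ)) ∧
      ∫ z, dbar (fun z => (g z : ℂ)) z * Φ z = 0 := by
  refine ⟨Complex.ofRealCLM.contDiff.comp (hg.of_le (by norm_cast)),
    hgc.comp_left (g := fun x : ℝ => (x : ℂ)) Complex.ofReal_zero, integral_eq_zero_of_ae ?_⟩
  have hGU : tsupport (fun z => (g z : ℂ)) ⊆ U := by
    refine (closure_mono fun z hz => ?_).trans hgU
    simpa using hz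
  filter_upwards [h] with z hz
  by_cases hzU : z ∈ U
  · simp [hz hzU]
  · have : dbar (fun z => (g z : ℂ)) z = 0 := by
      by_contra hne
      exact hzU (hGU (support_dbar_subset _ hne))
    simp [this]

lemma dbar_pow_mul {ψ g : ℂ → ℂ} (hψ : ContDiff ℝ 1 ψ) (hg : ContDiff ℝ 1 g) (k : ℕ) (c z : ℂ) :
    dbar (fun z => (c - ψ z) ^ (k + 1) * g z) z =
      (c - ψ z) ^ (k + 1) * dbar g z - (k + 1) * (c - ψ z) ^ k * dbar ψ z * g z := by
  have h1 := (((hψ.differentiable one_ne_zero z).hasFDerivAt.const_sub c).pow (k + 1)).mul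
    (hg.differentiable one_ne_zero z).hasFDerivAt
  simp only [dbar]
  rw [show (fun z => (c - ψ z) ^ (k + 1) * g z) = (fun z => (c - ψ z) ^ (k + 1)) * g from rfl,
    h1.fderiv]
  simp
  ring

lemma mul_genCauchy (ψ : ℂ → ℂ) (μ : Measure ℂ) (f : ℂ → ℂ) (k : ℕ) (g : ℂ → ℂ) (z : ℂ) : g z * genCauchy ψ k μ f z =
    ∫ w, g z * (ψ w - ψ z) ^ k / (w - z) * f w ∂μ := by
  rw [genCauchy, ← integral_const_mul]
  congr 1; ext w; ring

/-! ### Weak ∂̄-equations for generalized Cauchy transforms -/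

section Kernel

variable {μ : Measure ℂ} [SFinite μ] {f : ℂ → ℂ} {ψ : ℂ → ℂ}

/-- Integrating in z first, the kernel contributes a constant independent of w. This justifies every
use of Fubini below. -/
lemma integrable_div_sub_mul (hf : Integrable f μ) {κ : ℂ × ℂ → ℂ} (hκ : Measurable κ) {C R : ℝ}
    (hC : ∀ p, ‖κ p‖ ≤ C) (hR : ∀ p, R < ‖p.1‖ → κ p = 0) :
    Integrable (fun p : ℂ × ℂ => κ p / (p.2 - p.1) * f p.2) (volume.prod μ) := by
  obtain ⟨L, hL, hLw⟩ := exists_lintegral_closedBall_inv_enorm_sub_le R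
  have hm : AEStronglyMeasurable (fun p : ℂ × ℂ => κ p / (p.2 - p.1) * f p.2)
      (volume.prod μ) :=
    (hκ.div (measurable_snd.sub measurable_fst)).aestronglyMeasurable.mul hf.1.comp_snd
  refine ⟨hm, ?_⟩
  rw [HasFiniteIntegral, lintegral_prod_symm _ hm.enorm]
  have hle : ∀ w, ∫⁻ z, ‖κ (z, w) / (w - z) * f w‖ₑ ≤ ENNReal.ofReal C * L * ‖f w‖ₑ := fun w => by
    calc _ ≤ ∫⁻ z, (Metric.closedBall (0 : ℂ) R).indicator
          (fun z => ENNReal.ofReal C * ‖w - z‖ₑ⁻¹ * ‖f w‖ₑ) z := by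
          refine lintegral_mono fun z => ?_
          by_cases h : z ∈ Metric.closedBall (0 : ℂ) R
          · rw [Set.indicator_of_mem h, div_eq_mul_inv, enorm_mul, enorm_mul]
            gcongr
            · rw [← ofReal_norm]; exact ENNReal.ofReal_le_ofReal (hC _)
            · rcases eq_or_ne (w - z) 0 with h0 | h0
              · simp [h0]
              · rw [enorm_inv h0]
          · rw [hR _ (by simpa using h)]; simp
      _ = ENNReal.ofReal C * (∫⁻ z in Metric.closedBall (0 : ℂ) R, ‖w - z‖ₑ⁻¹) * ‖f w‖ₑ := by
          rw [lintegral_indicator Metric.isClosed_closedBall.measurableSet,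
            lintegral_mul_const' _ _ enorm_ne_top, lintegral_const_mul' _ _ ENNReal.ofReal_ne_top]
      _ ≤ _ := by gcongr; exact hLw w
  refine (lintegral_mono hle).trans_lt ?_
  rw [lintegral_const_mul' _ _ (ENNReal.mul_ne_top ENNReal.ofReal_ne_top hL)]
  exact ENNReal.mul_lt_top (ENNReal.mul_lt_top ENNReal.ofReal_lt_top hL.lt_top) hf.2

lemma exists_bound_of_hasCompactSupport {g : ℂ → ℂ} (hg : Continuous g)
    (hc : HasCompactSupport g) : ∃ C : ℝ, 0 ≤ C ∧ ∀ z, ‖g z‖ ≤ C := by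
  obtain ⟨C, hC⟩ := hg.bounded_above_of_compact_support hc
  exact ⟨C, (norm_nonneg _).trans (hC 0), hC⟩

lemma integrable_mul_pow_div_sub_mul (hf : Integrable f μ) (hψ : Continuous ψ)
    (hψc : HasCompactSupport ψ) (k : ℕ) {g : ℂ → ℂ} (hg : Continuous g)
    (hc : HasCompactSupport g) :
    Integrable (fun p : ℂ × ℂ => g p.1 * (ψ p.2 - ψ p.1) ^ k / (p.2 - p.1) * f p.2)
      (volume.prod μ) := by
  obtain ⟨C, hC0, hC⟩ := exists_bound_of_hasCompactSupport hg hc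
  obtain ⟨M, hM0, hM⟩ := exists_bound_of_hasCompactSupport hψ hψc
  obtain ⟨R, hR⟩ := hc.isCompact.isBounded.exists_norm_le
  refine integrable_div_sub_mul (κ := fun p => g p.1 * (ψ p.2 - ψ p.1) ^ k) hf
    (by fun_prop) (C := C * (M + M) ^ k) (R := R) (fun p => ?_) (fun p hp => ?_)
  · rw [norm_mul, norm_pow]
    gcongr
    · exact hC _
    · exact (norm_sub_le _ _).trans (add_le_add (hM _) (hM _))
  · have : g p.1 = 0 := by
      by_contra hne
      exact absurd (hR _ (subset_tsupport _ hne)) (not_le.2 hp)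
    simp [this]

lemma integrable_mul_genCauchy (hf : Integrable f μ) (hψ : Continuous ψ)
    (hψc : HasCompactSupport ψ) (k : ℕ) {g : ℂ → ℂ} (hg : Continuous g)
    (hc : HasCompactSupport g) : Integrable (fun z => g z * genCauchy ψ k μ f z) := by
  simp_rw [mul_genCauchy]
  exact (integrable_mul_pow_div_sub_mul hf hψ hψc k hg hc).integral_prod_left

lemma integral_mul_genCauchy (hf : Integrable f μ) (hψ : Continuous ψ)
    (hψc : HasCompactSupport ψ) (k : ℕ) {g : ℂ → ℂ} (hg : Continuous g)
    (hc : HasCompactSupport g) : ∫ z, g z * genCauchy ψ k μ f z =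
      ∫ w, (∫ z, g z * (ψ w - ψ z) ^ k / (w - z)) * f w ∂μ := by
  simp_rw [mul_genCauchy]
  rw [integral_integral_swap (integrable_mul_pow_div_sub_mul hf hψ hψc k hg hc)]
  simp_rw [integral_mul_const]

/-- Cauchy–Pompeiu is applied to (ψ(w) - ψ(z))^{k+1} g(z), which vanishes at z = w, so no point term
survives. -/
lemma integral_dbar_mul_pow_div_sub {g : ℂ → ℂ} (hψ : ContDiff ℝ 1 ψ) (hψc : HasCompactSupport ψ)
    (hg : ContDiff ℝ 1 g) (hc : HasCompactSupport g) (k : ℕ) (w : ℂ) :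
    ∫ z, dbar g z * (ψ w - ψ z) ^ (k + 1) / (w - z) =
      (k + 1) * ∫ z, (dbar ψ z * g z) * (ψ w - ψ z) ^ k / (w - z) := by
  have h1 := integral_dbar_div_sub (h := fun z => (ψ w - ψ z) ^ (k + 1) * g z)
    (((contDiff_const.sub hψ).pow _).mul hg) hc.mul_left w
  simp only [sub_self, ne_eq, Nat.add_eq_zero_iff, one_ne_zero, and_false, not_false_eq_true,
    zero_pow, zero_mul, mul_zero, dbar_pow_mul hψ hg] at h1
  have hint : ∀ (j : ℕ) {φ : ℂ → ℂ}, Continuous φ → HasCompactSupport φ →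
      Integrable fun z => φ z * (ψ w - ψ z) ^ j / (w - z) := fun j φ hφ hφc => by
    -- A point mass at w turns joint integrability into integrability in z for this particular w.
    have := (integrable_mul_pow_div_sub_mul (μ := Measure.dirac w) (f := fun _ => 1)
      (integrable_const _) hψ.continuous hψc j hφ hφc).integral_prod_left
    simpa using this
  have h2 := hint (k + 1) (continuous_dbar hg) (hasCompactSupport_dbar hc)
  have h3 := hint k (φ := fun z => dbar ψ z * g z)
    ((continuous_dbar hψ).mul hg.continuous) hc.mul_left
  rw [← integral_const_mul, ← sub_eq_zero, ← integral_sub h2 (h3.const_mul _), ← h1]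
  congr 1; ext z
  ring

/-- Weak form of ∂̄𝒞^{k+1} = -(k+1) ∂̄ψ 𝒞^k: the derivative is moved to the test function. -/
lemma ae_dbar_mul_genCauchy_eq_zero (hf : Integrable f μ) (hψ : ContDiff ℝ 1 ψ)
    (hψc : HasCompactSupport ψ) {U : Set ℂ} (hU : IsOpen U) {k : ℕ}
    (h : ∀ᵐ z, z ∈ U → genCauchy ψ (k + 1) μ f z = 0) :
    ∀ᵐ z, z ∈ U → dbar ψ z * genCauchy ψ k μ f z = 0 := by
  refine hU.ae_eq_zero_of_integral_contDiff_smul_eq_zero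
    ((integrable_mul_genCauchy hf hψ.continuous hψc k (continuous_dbar hψ)
      (hasCompactSupport_dbar hψc)).locallyIntegrable.locallyIntegrableOn U) fun g hg hgc hgU => ?_
  obtain ⟨hGd, hGc, h0⟩ := integral_dbar_ofReal_mul_eq_zero hg hgc hgU h
  set G : ℂ → ℂ := fun z => (g z : ℂ) with hG
  rw [integral_mul_genCauchy hf hψ.continuous hψc _ (continuous_dbar hGd)
    (hasCompactSupport_dbar hGc)] at h0
  simp_rw [integral_dbar_mul_pow_div_sub hψ hψc hGd hGc, mul_assoc ((k : ℂ) + 1),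
    integral_const_mul] at h0
  rw [← integral_mul_genCauchy hf hψ.continuous hψc _ (g := fun z => dbar ψ z * G z)
    ((continuous_dbar hψ).mul hGd.continuous) hGc.mul_left] at h0
  have h1 := (mul_eq_zero.1 h0).resolve_left (Nat.cast_add_one_ne_zero k)
  rw [← h1]
  congr 1; ext z
  rw [Complex.real_smul]; simp only [hG]; ring

/-- Weak form of ∂̄𝒞^0(fμ) = -π fμ. -/
lemma ae_eq_zero_of_genCauchy_zero (hf : Integrable f μ) (hψ : ContDiff ℝ 1 ψ)
    (hψc : HasCompactSupport ψ) {U : Set ℂ} (hU : IsOpen U)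
    (h : ∀ᵐ z, z ∈ U → genCauchy ψ 0 μ f z = 0) : ∀ᵐ z ∂μ, z ∈ U → f z = 0 := by
  refine hU.ae_eq_zero_of_integral_contDiff_smul_eq_zero
    (hf.locallyIntegrable.locallyIntegrableOn U) fun g hg hgc hgU => ?_
  obtain ⟨hGd, hGc, h0⟩ := integral_dbar_ofReal_mul_eq_zero hg hgc hgU h
  rw [integral_mul_genCauchy hf hψ.continuous hψc _ (continuous_dbar hGd)
    (hasCompactSupport_dbar hGc)] at h0
  simp_rw [pow_zero, mul_one, integral_dbar_div_sub hGd hGc, mul_assoc, integral_const_mul] at h0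
  have h1 := (mul_eq_zero.1 h0).resolve_left (by exact_mod_cast Real.pi_ne_zero)
  rw [← h1]
  rfl

end Kernel

/-! ### The pairing and multiplication operators on 𝒦 -/

namespace SpectralData

variable (D : SpectralData)

variable {D} in
lemma ext_ae {X Y : D.K} (h : ∀ i, (X i : ℂ → ℂ) =ᵐ[D.μ i] Y i) : X = Y :=
  lp.ext (funext fun i => Lp.ext (h i))

/-- μᵢ-a.e. information says nothing where dμᵢ/dμ₁ = 0, but there the i-th term of the pairing
vanishes. -/
lemma ae_of_rnDeriv_ne_zero (i : ℕ) {P : ℂ → Prop} (h : ∀ᵐ z ∂(D.μ i), P z) :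
    ∀ᵐ z ∂(D.μ 0), (D.μ i).rnDeriv (D.μ 0) z ≠ 0 → P z := by
  rw [← Measure.withDensity_rnDeriv_eq _ _ (D.ac_zero i),
    ae_withDensity_iff (Measure.measurable_rnDeriv _ _)] at h
  exact h

lemma pairing_ae_eq_mul {φ : ℂ → ℂ} {X X' : D.K}
    (h : ∀ i, (X i : ℂ → ℂ) =ᵐ[D.μ i] fun z => φ z * (X' i : ℂ → ℂ) z) (Y : D.K) :
    D.pairing X Y =ᵐ[D.μ 0] fun z => φ z * D.pairing X' Y z := by
  filter_upwards [ae_all_iff.2 fun i => D.ae_of_rnDeriv_ne_zero i (h i)] with z hz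
  rw [pairing, pairing, ← tsum_mul_left]
  congr 1; ext i
  by_cases h0 : (D.μ i).rnDeriv (D.μ 0) z = 0
  · simp [h0]
  · rw [hz i h0]; ring

lemma conj_pairing (X Y : D.K) (z : ℂ) :
    starRingEnd ℂ (D.pairing X Y z) = D.pairing Y X z := by
  rw [pairing, pairing, Complex.conj_tsum]
  congr 1; ext i
  simp only [map_mul, Complex.conj_ofReal, Complex.conj_conj]; ring

lemma integral_norm_sq (i : ℕ) (x : Lp ℂ 2 (D.μ i)) : ∫ z, ‖x z‖ ^ 2 ∂(D.μ i) = ‖x‖ ^ 2 := by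
  have h := L2.inner_def (𝕜 := ℂ) x x
  simp only [inner_self_eq_norm_sq_to_K] at h
  have h2 : ∫ z, ((‖x z‖ : ℂ)) ^ 2 ∂(D.μ i) = ((∫ z, ‖x z‖ ^ 2 ∂(D.μ i) : ℝ) : ℂ) := by
    rw [← integral_complex_ofReal]; simp
  have h3 : ((‖x‖ ^ 2 : ℝ) : ℂ) = ((∫ z, ‖x z‖ ^ 2 ∂(D.μ i) : ℝ) : ℂ) := by
    rw [← h2]; push_cast; exact h
  exact_mod_cast h3.symm

lemma summable_norm_sq (X : D.K) : Summable fun i => ‖X i‖ ^ 2 := by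
  have := (memℓp_gen_iff (p := 2) (by simp)).1 (lp.memℓp X)
  simpa using this

lemma integrable_coord_mul_conj (X Y : D.K) (i : ℕ) :
    Integrable (fun z => X i z * starRingEnd ℂ (Y i z)) (D.μ i) :=
  L2.integrable_inner (Y i) (X i)

lemma integrable_norm_sq (i : ℕ) (x : Lp ℂ 2 (D.μ i)) :
    Integrable (fun z => ‖x z‖ ^ 2) (D.μ i) :=
  (Lp.memLp x).integrable_norm_pow (by norm_num)

lemma integral_norm_coord_mul_conj_le (X Y : D.K) (i : ℕ) :
    ∫ z, ‖X i z * starRingEnd ℂ (Y i z)‖ ∂(D.μ i) ≤ ‖X i‖ ^ 2 + ‖Y i‖ ^ 2 := by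
  rw [← D.integral_norm_sq, ← D.integral_norm_sq,
    ← integral_add (D.integrable_norm_sq i _) (D.integrable_norm_sq i _)]
  refine integral_mono (D.integrable_coord_mul_conj X Y i).norm
    ((D.integrable_norm_sq i _).add (D.integrable_norm_sq i _)) fun z => ?_
  simp only [norm_mul, RCLike.norm_conj]
  nlinarith [sq_nonneg (‖X i z‖ - ‖Y i z‖), sq_nonneg ‖X i z‖, sq_nonneg ‖Y i z‖]

lemma integrable_pairing_term (X Y : D.K) (i : ℕ) :
    Integrable (fun z => X i z * starRingEnd ℂ (Y i z) *
      (((D.μ i).rnDeriv (D.μ 0) z).toReal : ℂ)) (D.μ 0) := by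
  have := (integrable_rnDeriv_smul_iff (D.ac_zero i)).2 (D.integrable_coord_mul_conj X Y i)
  refine this.congr (Filter.Eventually.of_forall fun z => ?_)
  simp only [Complex.real_smul]; ring

lemma integral_pairing_term (X Y : D.K) (i : ℕ) :
    ∫ z, X i z * starRingEnd ℂ (Y i z) * (((D.μ i).rnDeriv (D.μ 0) z).toReal : ℂ) ∂(D.μ 0) =
      inner ℂ (Y i) (X i) := by
  have := integral_rnDeriv_smul (D.ac_zero i) (f := fun z => X i z * starRingEnd ℂ (Y i z))
  rw [L2.inner_def]
  refine Eq.trans ?_ this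
  congr 1; ext z
  simp only [Complex.real_smul]; ring

lemma integral_norm_pairing_term_le (X Y : D.K) (i : ℕ) :
    ∫ z, ‖X i z * starRingEnd ℂ (Y i z) * (((D.μ i).rnDeriv (D.μ 0) z).toReal : ℂ)‖ ∂(D.μ 0) ≤
      ‖X i‖ ^ 2 + ‖Y i‖ ^ 2 := by
  refine le_of_eq_of_le ?_ (D.integral_norm_coord_mul_conj_le X Y i)
  rw [← integral_rnDeriv_smul (D.ac_zero i)]
  congr 1; ext z
  rw [norm_mul _ (Complex.ofReal _), Complex.norm_real, Real.norm_of_nonneg ENNReal.toReal_nonneg,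
    smul_eq_mul, mul_comm]

lemma summable_integral_norm_pairing_term (X Y : D.K) : Summable fun i =>
    ∫ z, ‖X i z * starRingEnd ℂ (Y i z) * (((D.μ i).rnDeriv (D.μ 0) z).toReal : ℂ)‖ ∂(D.μ 0) :=
  Summable.of_nonneg_of_le (fun _ => integral_nonneg fun _ => norm_nonneg _)
    (D.integral_norm_pairing_term_le X Y) ((D.summable_norm_sq X).add (D.summable_norm_sq Y))

/-- This turns orthogonality in 𝒦 into a scalar integral condition for μ₁. Sum and integral may be
exchanged because ‖Xᵢ‖² + ‖Yᵢ‖² is summable. -/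
lemma integral_pairing (X Y : D.K) : ∫ z, D.pairing X Y z ∂(D.μ 0) = inner ℂ Y X := by
  unfold pairing
  rw [← integral_tsum_of_summable_integral_norm (D.integrable_pairing_term X Y)
    (D.summable_integral_norm_pairing_term X Y), lp.inner_eq_tsum]
  simp_rw [integral_pairing_term]

lemma integrable_pairing (X Y : D.K) : Integrable (D.pairing X Y) (D.μ 0) := by
  have hm : Measurable (D.pairing X Y) := by
    refine Measurable.tsum fun i => ?_
    have h1 := (Lp.stronglyMeasurable (X i)).measurable
    have h2 := (Lp.stronglyMeasurable (Y i)).measurable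
    have h3 := Measure.measurable_rnDeriv (D.μ i) (D.μ 0)
    fun_prop
  refine ⟨hm.aestronglyMeasurable, ?_⟩
  refine (lintegral_mono fun z => enorm_tsum_le_tsum_enorm).trans_lt ?_
  rw [lintegral_tsum fun i => (D.integrable_pairing_term X Y i).1.enorm]
  simp_rw [← fun i => ofReal_integral_norm_eq_lintegral_enorm (D.integrable_pairing_term X Y i)]
  rw [← ENNReal.ofReal_tsum_of_nonneg (fun _ => integral_nonneg fun _ => norm_nonneg _)
    (D.summable_integral_norm_pairing_term X Y)]
  exact ENNReal.ofReal_lt_top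

lemma inner_mul_right (φ : ℂ → ℂ) (hφ : Measurable φ) (C : ℝ)
    (hC : ∀ z ∈ (D.μ 0).support, ‖φ z‖ ≤ C) (X Y : D.K) :
    inner ℂ Y (D.mul φ hφ C hC X) = ∫ z, φ z * D.pairing X Y z ∂(D.μ 0) := by
  rw [← integral_pairing]
  exact integral_congr_ae (D.pairing_ae_eq_mul (D.mul_coe φ hφ C hC X) Y)

lemma inner_mul_left (φ : ℂ → ℂ) (hφ : Measurable φ) (C : ℝ)
    (hC : ∀ z ∈ (D.μ 0).support, ‖φ z‖ ≤ C) (hC' : ∀ z ∈ (D.μ 0).support, ‖star (φ z)‖ ≤ C)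
    (X Y : D.K) :
    inner ℂ (D.mul φ hφ C hC X) Y =
      inner ℂ X (D.mul (fun z => star (φ z)) (by fun_prop) C hC' Y) := by
  rw [← inner_conj_symm, inner_mul_right, inner_mul_right, ← integral_conj]
  congr 1; ext z
  rw [map_mul, conj_pairing]; rfl

/-- Multiplication by the indicator function of a Borel set. -/
def chi (A : Set ℂ) (hA : MeasurableSet A) : D.K →L[ℂ] D.K :=
  D.mul (A.indicator 1) (measurable_one.indicator hA) 1 fun z _ => by
    by_cases h : z ∈ A <;> simp [h]

lemma chi_coe (A : Set ℂ) (hA : MeasurableSet A) (X : D.K) (i : ℕ) :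
    (D.chi A hA X i : ℂ → ℂ) =ᵐ[D.μ i] fun z => A.indicator 1 z * X i z :=
  D.mul_coe _ _ _ _ X i

/-- Multiplication by the conjugate coordinate. -/
def Mzbar : D.K →L[ℂ] D.K :=
  D.mul (fun z => star z) (by fun_prop) D.exists_bound.choose fun z hz => by
    rw [norm_star]; exact D.exists_bound.choose_spec z hz

lemma Mzbar_coe (X : D.K) (i : ℕ) :
    (D.Mzbar X i : ℂ → ℂ) =ᵐ[D.μ i] fun z => star z * X i z :=
  D.mul_coe _ _ _ _ X i

lemma inner_Mz_left (X Y : D.K) : inner ℂ (D.Mz X) Y = inner ℂ X (D.Mzbar Y) :=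
  D.inner_mul_left _ _ _ _ _ X Y

lemma adjoint_Mz : ContinuousLinearMap.adjoint D.Mz = D.Mzbar := by
  symm
  rw [ContinuousLinearMap.eq_adjoint_iff]
  intro x y
  rw [← inner_conj_symm, ← inner_Mz_left, inner_conj_symm]

lemma Mz_Mzbar (X : D.K) : D.Mz (D.Mzbar X) = D.Mzbar (D.Mz X) := by
  refine ext_ae fun i => ?_
  filter_upwards [D.Mz_coe (D.Mzbar X) i, D.Mzbar_coe X i, D.Mzbar_coe (D.Mz X) i,
    D.Mz_coe X i] with z h1 h2 h3 h4
  rw [h1, h2, h3, h4]; ring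

lemma chi_Mz (A : Set ℂ) (hA : MeasurableSet A) (X : D.K) :
    D.chi A hA (D.Mz X) = D.Mz (D.chi A hA X) := by
  refine ext_ae fun i => ?_
  filter_upwards [D.chi_coe A hA (D.Mz X) i, D.chi_coe A hA X i, D.Mz_coe (D.chi A hA X) i,
    D.Mz_coe X i] with z h1 h2 h3 h4
  rw [h1, h3, h2, h4]; ring

lemma chi_Mzbar (A : Set ℂ) (hA : MeasurableSet A) (X : D.K) :
    D.chi A hA (D.Mzbar X) = D.Mzbar (D.chi A hA X) := by
  refine ext_ae fun i => ?_
  filter_upwards [D.chi_coe A hA (D.Mzbar X) i, D.chi_coe A hA X i,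
    D.Mzbar_coe (D.chi A hA X) i, D.Mzbar_coe X i] with z h1 h2 h3 h4
  rw [h1, h3, h2, h4]; ring

lemma chi_chi (A : Set ℂ) (hA : MeasurableSet A) (X : D.K) :
    D.chi A hA (D.chi A hA X) = D.chi A hA X := by
  refine ext_ae fun i => ?_
  filter_upwards [D.chi_coe A hA (D.chi A hA X) i, D.chi_coe A hA X i] with z h1 h2
  rw [h1, h2]
  by_cases h : z ∈ A <;> simp [h]

/-- The test vector is (1, 0, 0, …), which lies in 𝒦 because μ₁ is finite. -/
lemma measure_eq_zero_of_chi_eq_zero (A : Set ℂ) (hA : MeasurableSet A) (h : D.chi A hA = 0) :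
    D.μ 0 A = 0 := by
  have h1 : MemLp (fun _ : ℂ => (1 : ℂ)) 2 (D.μ 0) := memLp_const _
  have h2 := D.chi_coe A hA (lp.single 2 0 (h1.toLp _)) 0
  rw [h] at h2
  rw [lp.single_apply_self] at h2
  have h3 : ∀ᵐ z ∂(D.μ 0), z ∉ A := by
    filter_upwards [h2, h1.coeFn_toLp, Lp.coeFn_zero ℂ 2 (D.μ 0)] with z h2 h3 h4 hzA
    rw [h3] at h2
    have h5 : (((0 : D.K →L[ℂ] D.K) (lp.single 2 0 (h1.toLp _)) : D.K) 0 : ℂ → ℂ) z = 0 := h4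
    rw [h5] at h2
    simp [hzA] at h2
  simpa [ae_iff] using h3

/-- The restriction of `M_z` to a closed reducing subspace is normal. -/
lemma isStarNormal_restrict (I : Submodule ℂ D.K) [CompleteSpace I] (hI : ∀ x ∈ I, D.Mz x ∈ I)
    (hI' : ∀ x ∈ I, D.Mzbar x ∈ I) : IsStarNormal (D.Mz.restrict hI : I →L[ℂ] I) := by
  have hadj : star (D.Mz.restrict hI : I →L[ℂ] I) = D.Mzbar.restrict hI' := by
    rw [ContinuousLinearMap.star_eq_adjoint]
    symm
    rw [ContinuousLinearMap.eq_adjoint_iff]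
    intro x y
    change inner ℂ (D.Mzbar x) (y : D.K) = inner ℂ (x : D.K) (D.Mz y)
    rw [← inner_conj_symm, ← inner_Mz_left, inner_conj_symm]
  rw [isStarNormal_iff, hadj]
  exact ContinuousLinearMap.ext fun x => Subtype.ext (D.Mz_Mzbar x).symm

end SpectralData

/-! ### Minimality and polynomials in S -/

namespace SubnormalModel

variable (T : SubnormalModel)

/-- By minimality of the normal extension, a Borel set on which all functions of `ℋ` vanish is
null. -/
lemma measure_eq_zero_of_chi_H (A : Set ℂ) (hA : MeasurableSet A)
    (h : ∀ x ∈ T.H, T.chi A hA x = 0) : T.μ 0 A = 0 := by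
  refine T.measure_eq_zero_of_chi_eq_zero A hA ?_
  have hle : (Submodule.span ℂ {y | ∃ x ∈ T.H, ∃ k : ℕ,
      y = ((ContinuousLinearMap.adjoint T.Mz) ^ k) x}).topologicalClosure ≤
      (T.chi A hA).ker := by
    refine Submodule.topologicalClosure_minimal _ (Submodule.span_le.2 ?_)
      (T.chi A hA).isClosed_ker
    rintro y ⟨x, hx, k, rfl⟩
    rw [T.adjoint_Mz]
    change T.chi A hA ((T.Mzbar ^ k) x) = 0
    induction k with
    | zero => exact h x hx
    | succ k ih =>
      rw [pow_succ']
      change T.chi A hA (T.Mzbar ((T.Mzbar ^ k) x)) = 0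
      rw [T.chi_Mzbar, ih, map_zero]
  rw [T.minimal] at hle
  ext1 x
  exact hle Submodule.mem_top

lemma aeval_S_coe (p : ℂ[X]) (u : T.H) (i : ℕ) :
    ((aeval T.S p u : T.K) i : ℂ → ℂ) =ᵐ[T.μ i] fun z => p.eval z * (u : T.K) i z := by
  induction p using Polynomial.induction_on' generalizing u with
  | add p q hp hq =>
    have h : ((aeval T.S (p + q) u : T.H) : T.K) i =
        ((aeval T.S p u : T.H) : T.K) i + ((aeval T.S q u : T.H) : T.K) i := by
      rw [aeval_def, eval₂_add]; rfl
    rw [h]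
    filter_upwards [hp u, hq u, Lp.coeFn_add (((aeval T.S p u : T.H) : T.K) i)
      (((aeval T.S q u : T.H) : T.K) i)] with z h1 h2 h3
    rw [h3, Pi.add_apply, h1, h2, eval_add]; ring
  | monomial n a =>
    induction n generalizing u with
    | zero =>
      have h : ((aeval T.S (monomial 0 a) u : T.H) : T.K) i = a • ((u : T.K) i) := by
        rw [aeval_monomial, pow_zero, mul_one, Algebra.algebraMap_eq_smul_one]; rfl
      rw [h]
      filter_upwards [Lp.coeFn_smul a ((u : T.K) i)] with z h1
      rw [h1]; simp
    | succ n ih =>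
      have h : aeval T.S (monomial (n + 1) a) u = aeval T.S (monomial n a) (T.S u) := by
        rw [aeval_monomial, aeval_monomial, pow_succ, ← mul_assoc]; rfl
      rw [h]
      filter_upwards [ih (T.S u), T.Mz_coe u i] with z h1 h2
      rw [h1]
      change _ * ((T.Mz u : T.K) i : ℂ → ℂ) z = _
      rw [h2]; simp; ring

end SubnormalModel

/-! ### Transforms of positive order -/

section GenCauchy

variable {ψ : ℂ → ℂ}

/-- One factor ψ(w) - ψ(z) cancels the pole because ψ is Lipschitz; the remaining factors are
bounded. -/
lemma exists_norm_pow_div_sub_le (hψ : ContDiff ℝ 1 ψ) (hψc : HasCompactSupport ψ) (k : ℕ) :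
    ∃ C : ℝ, ∀ z w : ℂ, ‖(ψ w - ψ z) ^ (k + 1) / (w - z)‖ ≤ C := by
  obtain ⟨K, hK⟩ := hψ.lipschitzWith_of_hasCompactSupport hψc one_ne_zero
  obtain ⟨M, hM0, hM⟩ := exists_bound_of_hasCompactSupport hψ.continuous hψc
  refine ⟨(M + M) ^ k * K, fun z w => ?_⟩
  rw [pow_succ, mul_div_assoc, norm_mul, norm_pow, norm_div]
  have h1 : ‖ψ w - ψ z‖ ≤ M + M := (norm_sub_le _ _).trans (add_le_add (hM _) (hM _))
  have h2 : ‖ψ w - ψ z‖ / ‖w - z‖ ≤ K :=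
    div_le_of_le_mul₀ (norm_nonneg _) K.2 (hK.norm_sub_le w z)
  gcongr

/-- Dominated convergence with the bounded kernel. The integrand is continuous in z only for w ≠ z,
hence the condition that z carry no mass. -/
lemma continuousAt_genCauchy_succ {μ : Measure ℂ} {f : ℂ → ℂ} (hf : Integrable f μ)
    (hψ : ContDiff ℝ 1 ψ) (hψc : HasCompactSupport ψ) (k : ℕ) {z : ℂ} (hz : μ {z} = 0) :
    ContinuousAt (genCauchy ψ (k + 1) μ f) z := by
  obtain ⟨C, hC⟩ := exists_norm_pow_div_sub_le hψ hψc k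
  have hψ' := hψ.continuous
  refine continuousAt_of_dominated (bound := fun w => C * ‖f w‖)
    (Filter.Eventually.of_forall fun x => ?_) (Filter.Eventually.of_forall fun x =>
      Filter.Eventually.of_forall fun w => ?_) (hf.norm.const_mul C) ?_
  · exact (Measurable.aestronglyMeasurable (by fun_prop)).mul hf.1
  · rw [norm_mul]
    exact mul_le_mul_of_nonneg_right (hC x w) (norm_nonneg _)
  · have : ∀ᵐ w ∂μ, w ≠ z := by simpa [ae_iff] using hz
    filter_upwards [this] with w hw
    have : w - z ≠ 0 := sub_ne_zero.2 hw
    fun_prop (disch := assumption)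

end GenCauchy

lemma SpectralData.pairing_zero_left (D : SpectralData) (Y : D.K) :
    D.pairing 0 Y =ᵐ[D.μ 0] 0 := by
  have h := D.pairing_ae_eq_mul (φ := 0) (X := 0) (X' := 0) (fun i => by
    filter_upwards [Lp.coeFn_zero ℂ 2 (D.μ i)] with z hz
    rw [Pi.zero_apply, zero_mul]
    exact hz) Y
  filter_upwards [h] with z hz
  rw [hz]; simp

/-! ### Vanishing of the transforms outside Int σ(S) -/

namespace SubnormalModel

variable {T : SubnormalModel} {ψ : ℂ → ℂ}

/-- q(S)⁻¹ acts as division by q. The product form avoids dividing at the zeros of q. -/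
lemma coe_ae_eq_eval_mul_inverse {q : ℂ[X]} (hq : IsUnit (aeval T.S q)) (x : T.H) (i : ℕ) :
    ((x : T.K) i : ℂ → ℂ) =ᵐ[T.μ i]
      fun z => q.eval z * ((Ring.inverse (aeval T.S q) x : T.H) : T.K) i z := by
  have h := T.aeval_S_coe q (Ring.inverse (aeval T.S q) x) i
  have h2 : aeval T.S q (Ring.inverse (aeval T.S q) x) = x := by
    change (aeval T.S q * Ring.inverse (aeval T.S q)) x = x
    rw [Ring.mul_inverse_cancel _ hq]; rfl
  rwa [h2] at h

lemma isUnit_aeval_X_sub_C {z : ℂ} (hz : z ∉ spectrum ℂ T.S) :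
    IsUnit (aeval T.S (X - C z)) := by
  rw [spectrum.notMem_iff] at hz
  have : aeval T.S (X - C z) = -(algebraMap ℂ (T.H →L[ℂ] T.H) z - T.S) := by
    rw [aeval_sub, aeval_X, aeval_C, neg_sub]
  rw [this]
  exact hz.neg

/-- Off the spectrum every x in ℋ equals (w - z)y with y in ℋ, so it vanishes at w = z; minimality
then excludes an atom. -/
lemma measure_singleton_eq_zero {z : ℂ} (hz : z ∉ spectrum ℂ T.S) : T.μ 0 {z} = 0 := by
  refine T.measure_eq_zero_of_chi_H _ (measurableSet_singleton z) fun x hx =>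
    SpectralData.ext_ae fun i => ?_
  filter_upwards [coe_ae_eq_eval_mul_inverse (isUnit_aeval_X_sub_C hz) ⟨x, hx⟩ i,
    T.chi_coe _ (measurableSet_singleton z) x i, Lp.coeFn_zero ℂ 2 (T.μ i)] with w h1 h2 h3
  rw [h2]
  change _ = ((0 : Lp ℂ 2 (T.μ i)) : ℂ → ℂ) w
  rw [h3]
  by_cases h : w = z
  · change (x i : ℂ → ℂ) w = _ at h1
    rw [h1, h]; simp
  · simp [h]

/-- Multiplication by a power of a continuous compactly supported function. -/
def mulPow (T : SubnormalModel) (hψ : Continuous ψ) (hψc : HasCompactSupport ψ) (m : ℕ) :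
    T.K →L[ℂ] T.K :=
  T.mul (fun z => ψ z ^ m) (by fun_prop)
    ((exists_bound_of_hasCompactSupport hψ hψc).choose ^ m) fun z _ => by
      rw [norm_pow]
      exact pow_le_pow_left₀ (norm_nonneg _)
        ((exists_bound_of_hasCompactSupport hψ hψc).choose_spec.2 z) m

lemma mulPow_coe (hψ : Continuous ψ) (hψc : HasCompactSupport ψ) (m : ℕ) (x : T.K) (i : ℕ) :
    (T.mulPow hψ hψc m x i : ℂ → ℂ) =ᵐ[T.μ i] fun z => ψ z ^ m * x i z :=
  T.mul_coe _ _ _ _ x i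

lemma mulPow_mem_Kpsi (hψ : Continuous ψ) (hψc : HasCompactSupport ψ) {m n : ℕ} (hm : m ≤ n)
    {x : T.K} (hx : x ∈ T.H) : T.mulPow hψ hψc m x ∈ T.Kpsi ψ n :=
  Submodule.le_topologicalClosure _ (Submodule.subset_span ⟨x, hx, m, hm, T.mulPow_coe hψ hψc m x⟩)

lemma H_le_Kpsi (ψ : ℂ → ℂ) (n : ℕ) : T.H ≤ T.Kpsi ψ n := fun x hx =>
  Submodule.le_topologicalClosure _ (Submodule.subset_span ⟨x, hx, 0, Nat.zero_le _, fun i => by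
    filter_upwards with z; simp⟩)

lemma Kpsi_le {n : ℕ} (hψ : Continuous ψ) (hψc : HasCompactSupport ψ) {V : Submodule ℂ T.K}
    (hV : IsClosed (V : Set T.K)) (h : ∀ x ∈ T.H, ∀ m ≤ n, T.mulPow hψ hψc m x ∈ V) :
    T.Kpsi ψ n ≤ V := by
  refine Submodule.topologicalClosure_minimal _ (Submodule.span_le.2 ?_) hV
  rintro y ⟨x, hx, m, hm, hy⟩
  have : y = T.mulPow hψ hψc m x :=
    SpectralData.ext_ae fun i => (hy i).trans (T.mulPow_coe hψ hψc m x i).symm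
  rw [this]
  exact h x hx m hm

lemma integrable_pow_mul_pairing (hψ : Continuous ψ) (hψc : HasCompactSupport ψ) (m : ℕ)
    (X Y : T.K) : Integrable (fun w => ψ w ^ m * T.pairing X Y w) (T.μ 0) :=
  (T.integrable_pairing (T.mulPow hψ hψc m X) Y).congr
    (T.pairing_ae_eq_mul (T.mulPow_coe hψ hψc m X) Y)

lemma integral_sub_pow_mul_pairing_eq_zero (hψ : Continuous ψ) (hψc : HasCompactSupport ψ)
    {n k : ℕ} (hk : k ≤ n) (c : ℂ) {x G : T.K} (hx : x ∈ T.H) (hG : G ∈ (T.Kpsi ψ n)ᗮ) :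
    ∫ w, (ψ w - c) ^ k * T.pairing x G w ∂(T.μ 0) = 0 := by
  have h0 : ∀ m ≤ k, ∫ w, ψ w ^ m * T.pairing x G w ∂(T.μ 0) = 0 := fun m hm => by
    have h1 : inner ℂ G (T.mulPow hψ hψc m x) = 0 :=
      (Submodule.mem_orthogonal' _ _).1 hG _ (mulPow_mem_Kpsi hψ hψc (hm.trans hk) hx)
    rwa [mulPow, T.inner_mul_right] at h1
  have h1 : ∀ w, (ψ w - c) ^ k * T.pairing x G w = ∑ m ∈ Finset.range (k + 1),
      ((-c) ^ (k - m) * (k.choose m : ℂ)) * (ψ w ^ m * T.pairing x G w) := fun w => by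
    rw [sub_eq_add_neg, add_pow, Finset.sum_mul]
    refine Finset.sum_congr rfl fun m _ => by ring
  simp_rw [h1]
  rw [integral_finsetSum _ fun m _ => (integrable_pow_mul_pairing hψ hψc m x G).const_mul _]
  refine Finset.sum_eq_zero fun m hm => ?_
  rw [integral_const_mul, h0 m (Nat.lt_succ_iff.1 (Finset.mem_range.1 hm)), mul_zero]

/-- Writing x = (w - z)y with y in ℋ cancels the kernel. What remains is the integral of (ψ -
ψ(z))^k ⟨y, G⟩, a combination of inner products of ψ^m y with G. -/
lemma genCauchy_eq_zero_of_notMem_spectrum (hψ : Continuous ψ) (hψc : HasCompactSupport ψ)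
    {n k : ℕ} (hk : k ≤ n) {z : ℂ} (hz : z ∉ spectrum ℂ T.S) (x : T.H) {G : T.K}
    (hG : G ∈ (T.Kpsi ψ n)ᗮ) : genCauchy ψ k (T.μ 0) (T.pairing x G) z = 0 := by
  set y : T.H := Ring.inverse (aeval T.S (X - C z)) x with hy
  have h1 := T.pairing_ae_eq_mul (X := x) (X' := y)
    (fun i => coe_ae_eq_eval_mul_inverse (isUnit_aeval_X_sub_C hz) x i) G
  have h2 : ∀ᵐ w ∂(T.μ 0), w ≠ z := by simpa [ae_iff] using measure_singleton_eq_zero hz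
  rw [genCauchy, ← integral_sub_pow_mul_pairing_eq_zero hψ hψc hk (ψ z) y.2 hG]
  refine integral_congr_ae ?_
  filter_upwards [h1, h2] with w h1 h2
  have : w - z ≠ 0 := sub_ne_zero.2 h2
  rw [h1]
  simp only [eval_sub, eval_X, eval_C]
  field_simp

lemma exists_genCauchy_succ_eq_inner (T : SubnormalModel) (hψ : ContDiff ℝ 1 ψ)
    (hψc : HasCompactSupport ψ) (k : ℕ) (z : ℂ) : ∃ A : T.K →L[ℂ] T.K, ∀ X Y : T.K,
      genCauchy ψ (k + 1) (T.μ 0) (T.pairing X Y) z = inner ℂ Y (A X) := by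
  obtain ⟨C, hC⟩ := exists_norm_pow_div_sub_le hψ hψc k
  have hψ' := hψ.continuous
  refine ⟨T.mul (fun w => (ψ w - ψ z) ^ (k + 1) / (w - z)) (by fun_prop) C
    (fun w _ => hC z w), fun X Y => ?_⟩
  rw [T.inner_mul_right, genCauchy]

/-- For positive order the transform at a fixed point is an inner product with a bounded
multiplication operator, so it depends continuously on Y. -/
lemma genCauchy_succ_eq_zero_of_mem_closure (hψ : ContDiff ℝ 1 ψ) (hψc : HasCompactSupport ψ)
    (k : ℕ) (z : ℂ) (X : T.K) {s : Set T.K}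
    (hs : ∀ Y ∈ s, genCauchy ψ (k + 1) (T.μ 0) (T.pairing X Y) z = 0) {Y : T.K}
    (hY : Y ∈ closure s) : genCauchy ψ (k + 1) (T.μ 0) (T.pairing X Y) z = 0 := by
  obtain ⟨A, hA⟩ := T.exists_genCauchy_succ_eq_inner hψ hψc k z
  simp_rw [hA] at hs ⊢
  have hcl : IsClosed {Y : T.K | inner ℂ Y (A X) = 0} :=
    isClosed_eq (by fun_prop) continuous_const
  exact closure_minimal hs hcl hY

lemma genCauchy_succ_eq_zero_of_notMem_interior (hψ : ContDiff ℝ 1 ψ)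
    (hψc : HasCompactSupport ψ) {n k : ℕ} (hk : k + 1 ≤ n) {z : ℂ}
    (hz : z ∉ interior (spectrum ℂ T.S)) (hzμ : T.μ 0 {z} = 0) (x : T.H) {G : T.K}
    (hG : G ∈ (T.Kpsi ψ n)ᗮ) : genCauchy ψ (k + 1) (T.μ 0) (T.pairing x G) z = 0 := by
  have hz' : z ∈ closure (spectrum ℂ T.S)ᶜ := by rwa [closure_compl]
  have hc := continuousAt_genCauchy_succ (T.integrable_pairing x G) hψ hψc k hzμ
  have := hc.continuousWithinAt.mem_closure (s := (spectrum ℂ T.S)ᶜ) (t := {0}) hz'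
    fun w hw => genCauchy_eq_zero_of_notMem_spectrum hψ.continuous hψc hk hw x hG
  simpa using this

/-! ### Nonvanishing transforms and the sets `E` -/

/-- Eliminating N - 1 rows leaves one entry of the last row. The point is then in E₁, unless it was
removed for lying in the closure of the other sets, which suffices as well. -/
lemma mem_closure_iUnion_E {N : ℕ} (hN : 1 < N) (F : Fin N → T.H) (G : T.K) (i : Fin N) {z : ℂ}
    (hz : z ∈ interior (spectrum ℂ T.S)) (hzμ : T.μ 0 {z} = 0)
    (hne : genCauchy ψ (N - 1) (T.μ 0) (T.pairing (F i) G) z ≠ 0) :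
    z ∈ closure (⋃ k ∈ Finset.Icc 1 N, T.E ψ F G k) := by
  by_contra hcl
  have hsub : Subsingleton (Fin (N - (N - 1))) := by
    rw [show N - (N - 1) = 1 by omega]; infer_instance
  -- The single retained column is i.
  let c : Fin (N - (N - 1)) ↪o Fin N :=
    ⟨⟨fun _ => i, fun a b _ => Subsingleton.elim a b⟩, fun {a b} => by
      simp [Subsingleton.elim a b]⟩
  refine hcl (subset_closure ?_)
  refine Set.mem_biUnion (x := 1) (by simp; omega) ?_
  rw [E, Eaux, if_neg (by omega)]
  refine ⟨Set.mem_iUnion.2 ⟨c, hz, hzμ, ?_⟩, fun h => hcl (closure_mono ?_ h)⟩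
  · rw [Matrix.det_eq_elem_of_subsingleton _ (⟨0, by omega⟩ : Fin (N - (N - 1)))]
    exact hne
  · refine Set.iUnion_subset fun e => ?_
    have he := e.2
    refine fun w hw => Set.mem_biUnion (x := N - e) (by simp; omega) ?_
    rw [E, show N - (N - (e : ℕ)) = e by omega]
    exact hw

/-! ### Descent to order zero and rational combinations -/

/-- If all the generalized Cauchy transforms of order `n` vanish almost everywhere on an open set,
then so does the density. -/
lemma ae_pairing_eq_zero (hψ : ContDiff ℝ 1 ψ) (hψc : HasCompactSupport ψ)
    (harea : volume (spectrum ℂ T.S ∩ {z | dbar ψ z = 0}) = 0) {n : ℕ} (x : T.H) {G : T.K}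
    (hG : G ∈ (T.Kpsi ψ n)ᗮ) {B : Set ℂ} (hB : IsOpen B)
    (h : ∀ᵐ z, z ∈ B → genCauchy ψ n (T.μ 0) (T.pairing x G) z = 0) :
    ∀ᵐ z ∂(T.μ 0), z ∈ B → T.pairing x G z = 0 := by
  have hf := T.integrable_pairing x G
  have harea' : ∀ᵐ z, ¬ (z ∈ spectrum ℂ T.S ∧ dbar ψ z = 0) := by
    rw [ae_iff]; simp only [not_not]; exact harea
  have key : ∀ j ≤ n, ∀ᵐ z, z ∈ B → genCauchy ψ (n - j) (T.μ 0) (T.pairing x G) z = 0 := by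
    intro j
    induction j with
    | zero => exact fun _ => h
    | succ j ih =>
      intro hj
      have h1 := ih (by omega)
      rw [show n - j = n - (j + 1) + 1 by omega] at h1
      filter_upwards [ae_dbar_mul_genCauchy_eq_zero hf hψ hψc hB h1, harea'] with z h2 h3 hzB
      -- On σ(S) the factor ∂̄ψ is nonzero almost everywhere and can be cancelled; off σ(S) every
      -- order up to n vanishes by the resolvent argument.
      by_cases hz : z ∈ spectrum ℂ T.S
      · exact (mul_eq_zero.1 (h2 hzB)).resolve_left fun h0 => h3 ⟨hz, h0⟩
      · exact genCauchy_eq_zero_of_notMem_spectrum hψ.continuous hψc (by omega) hz x hG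
  have h0 := key n le_rfl
  rw [Nat.sub_self] at h0
  exact ae_eq_zero_of_genCauchy_zero hf hψ hψc hB h0

/-- Applying p(S)q(S)⁻¹ multiplies the pairing by p/q a.e.: the zeros of q are finitely many points
off σ(S), hence not atoms. -/
lemma ae_pairing_rational_eq_zero {x : T.H} {G : T.K} {B : Set ℂ}
    (h : ∀ᵐ z ∂(T.μ 0), z ∈ B → T.pairing x G z = 0) (p : ℂ[X]) {q : ℂ[X]}
    (hq : ∀ z ∈ spectrum ℂ T.S, q.eval z ≠ 0) :
    ∀ᵐ z ∂(T.μ 0), z ∈ B →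
      T.pairing ((aeval T.S p * Ring.inverse (aeval T.S q)) x : T.H) G z = 0 := by
  set u : T.H := Ring.inverse (aeval T.S q) x with hu
  have h1 := T.pairing_ae_eq_mul (X := (aeval T.S p u : T.H)) (X' := u) (T.aeval_S_coe p u) G
  suffices h2 : ∀ᵐ z ∂(T.μ 0), z ∈ B → T.pairing u G z = 0 by
    filter_upwards [h1, h2] with z h1 h2 hz
    exact h1.trans (by rw [h2 hz, mul_zero])
  -- In the excluded cases `Ring.inverse` takes the value 0, so u = 0.
  by_cases hun : IsUnit (aeval T.S q) ∧ q ≠ 0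
  · have h3 := T.pairing_ae_eq_mul (X := x) (X' := u) (coe_ae_eq_eval_mul_inverse hun.1 x) G
    have h4 : ∀ᵐ z ∂(T.μ 0), q.eval z ≠ 0 := by
      have hfin : {z | q.eval z = 0}.Finite := by
        refine (q.roots.toFinset.finite_toSet).subset fun z hz => ?_
        simpa [hun.2] using hz
      have : T.μ 0 {z | q.eval z = 0} = 0 := by
        rw [← Set.biUnion_of_singleton {z | q.eval z = 0},
          measure_biUnion_null_iff hfin.countable]
        exact fun z hz => measure_singleton_eq_zero fun hzs => hq z hzs hz
      simpa [ae_iff] using this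
    filter_upwards [h, h3, h4] with z h h3 h4 hz
    rw [h hz] at h3
    exact (mul_eq_zero.1 h3.symm).resolve_left h4
  · have hu0 : u = 0 := by
      have : Ring.inverse (aeval T.S q) = 0 := by
        by_cases hq0 : q = 0
        · rw [hq0, aeval_zero, Ring.inverse_zero]
        · exact Ring.inverse_non_unit _ fun hu => hun ⟨hu, hq0⟩
      rw [hu, this]; rfl
    filter_upwards [T.pairing_zero_left G] with z hz _
    rw [hu0]
    exact hz

lemma inner_eq_zero_of_ratClosure {N : ℕ} {F : Fin N → T.H}
    (hF : ratClosure T.S F = Set.univ) (A : T.K →L[ℂ] T.K) (G : T.K)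
    (h : ∀ (i : Fin N) (p q : ℂ[X]), (∀ z ∈ spectrum ℂ T.S, q.eval z ≠ 0) →
      inner ℂ G (A ((aeval T.S p * Ring.inverse (aeval T.S q)) (F i) : T.H)) = 0) (x : T.H) :
    inner ℂ G (A x) = 0 := by
  have hclosed : IsClosed {x : T.H | inner ℂ G (A x) = 0} :=
    isClosed_eq (by fun_prop) continuous_const
  have hmem : x ∈ ratClosure T.S F := by rw [hF]; trivial
  rw [ratClosure] at hmem
  refine closure_minimal ?_ hclosed hmem
  intro y hy
  obtain ⟨p, q, hq, hy⟩ := hy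
  rw [Set.mem_ofPred_eq, hy, Submodule.coe_sum, map_sum, inner_sum]
  exact Finset.sum_eq_zero fun i _ => h i (p i) (q i) (hq i)

/-! ### Reducing subspaces and purity -/

/-- If the pairings of the cyclic vectors with `𝒦_n^ψ`'s orthogonal complement vanish on a set `B`,
then multiplication by any bounded function supported in `B` leaves `𝒦_n^ψ` invariant. -/
lemma mul_mem_Kpsi {N : ℕ} {F : Fin N → T.H} (hF : ratClosure T.S F = Set.univ)
    (hψ : Continuous ψ) (hψc : HasCompactSupport ψ) {n : ℕ} {B : Set ℂ}
    (h : ∀ G ∈ (T.Kpsi ψ n)ᗮ, ∀ j, ∀ᵐ z ∂(T.μ 0), z ∈ B → T.pairing (F j) G z = 0)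
    {φ : ℂ → ℂ} (hφ : Measurable φ) {C : ℝ} (hC : ∀ z ∈ (T.μ 0).support, ‖φ z‖ ≤ C)
    (hφB : ∀ z ∉ B, φ z = 0) {y : T.K} (hy : y ∈ T.Kpsi ψ n) :
    T.mul φ hφ C hC y ∈ T.Kpsi ψ n := by
  have hcl : IsClosed (T.Kpsi ψ n : Set T.K) := Submodule.isClosed_topologicalClosure _
  have : CompleteSpace (T.Kpsi ψ n) := hcl.completeSpace_coe
  suffices hle : T.Kpsi ψ n ≤ (T.Kpsi ψ n).comap (T.mul φ hφ C hC).toLinearMap from hle hy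
  refine Kpsi_le hψ hψc (hcl.preimage (T.mul φ hφ C hC).continuous) fun x hx m _ => ?_
  change T.mul φ hφ C hC (T.mulPow hψ hψc m x) ∈ T.Kpsi ψ n
  -- A closed subspace is its own double complement, so membership becomes orthogonality to each G,
  -- which can be tested on the generators.
  rw [← Submodule.orthogonal_orthogonal (T.Kpsi ψ n), Submodule.mem_orthogonal]
  intro G hG
  refine inner_eq_zero_of_ratClosure hF ((T.mul φ hφ C hC).comp (T.mulPow hψ hψc m)) G
    (fun i p q hq => ?_) ⟨x, hx⟩
  rw [ContinuousLinearMap.comp_apply]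
  rw [T.inner_mul_right]
  refine integral_eq_zero_of_ae ?_
  filter_upwards [ae_pairing_rational_eq_zero (h G hG i) p hq,
    T.pairing_ae_eq_mul (T.mulPow_coe hψ hψc m
      ((aeval T.S p * Ring.inverse (aeval T.S q)) (F i) : T.H)) G] with z h1 h2
  rw [h2]
  by_cases hz : z ∈ B
  · rw [h1 hz]; simp
  · rw [hφB z hz]; simp

/-- Multiplication by 1_B, z1_B and z̄1_B preserves `Kpsi`, so the vectors of `Kpsi` carried by B
form a closed reducing subspace. M_z is normal there, purity forces it to be zero, and minimality
finishes. -/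
lemma measure_eq_zero_of_pairing_eq_zero {N : ℕ} {F : Fin N → T.H}
    (hF : ratClosure T.S F = Set.univ) (hψ : Continuous ψ) (hψc : HasCompactSupport ψ) {n : ℕ}
    (hpure : IsPureOn T.Mz (T.Kpsi ψ n)) {B : Set ℂ} (hB : MeasurableSet B)
    (h : ∀ G ∈ (T.Kpsi ψ n)ᗮ, ∀ j, ∀ᵐ z ∂(T.μ 0), z ∈ B → T.pairing (F j) G z = 0) :
    T.μ 0 B = 0 := by
  obtain ⟨R, hR⟩ := T.exists_bound
  have hmem : ∀ {φ : ℂ → ℂ} (hφ : Measurable φ) {C : ℝ}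
      (hC : ∀ z ∈ (T.μ 0).support, ‖φ z‖ ≤ C), (∀ z ∉ B, φ z = 0) → ∀ y ∈ T.Kpsi ψ n,
      T.mul φ hφ C hC y ∈ T.Kpsi ψ n := fun hφ _ hC hφB y hy =>
    mul_mem_Kpsi hF hψ hψc h hφ hC hφB hy
  have hchi : ∀ y ∈ T.Kpsi ψ n, T.chi B hB y ∈ T.Kpsi ψ n :=
    hmem _ _ fun z hz => by simp [hz]
  have hbound : ∀ z ∈ (T.μ 0).support, ‖B.indicator (fun z => z) z‖ ≤ R := fun z hz =>
    (norm_indicator_le_norm_self _ _).trans (hR z hz)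
  have hbound' : ∀ z ∈ (T.μ 0).support, ‖B.indicator (fun z => star z) z‖ ≤ R := fun z hz =>
    (norm_indicator_le_norm_self _ _).trans (by rw [norm_star]; exact hR z hz)
  have hMz : ∀ y ∈ T.Kpsi ψ n, T.Mz (T.chi B hB y) ∈ T.Kpsi ψ n := fun y hy => by
    have h1 := hmem (measurable_id.indicator hB) hbound (fun z hz => by simp [hz]) y hy
    convert h1 using 1
    refine SpectralData.ext_ae fun i => ?_
    filter_upwards [T.Mz_coe (T.chi B hB y) i, T.chi_coe B hB y i,
      T.mul_coe _ (measurable_id.indicator hB) R hbound y i] with z h1 h2 h3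
    rw [h1, h2]
    refine Eq.trans ?_ h3.symm
    by_cases hz : z ∈ B <;> simp [hz]
  have hMzbar : ∀ y ∈ T.Kpsi ψ n, T.Mzbar (T.chi B hB y) ∈ T.Kpsi ψ n := fun y hy => by
    have hm : Measurable (B.indicator fun z : ℂ => star z) :=
      Measurable.indicator (by fun_prop) hB
    have h1 := hmem hm hbound' (fun z hz => by simp [hz]) y hy
    convert h1 using 1
    refine SpectralData.ext_ae fun i => ?_
    filter_upwards [T.Mzbar_coe (T.chi B hB y) i, T.chi_coe B hB y i,
      T.mul_coe _ hm R hbound' y i] with z h1 h2 h3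
    rw [h1, h2, h3]
    by_cases hz : z ∈ B <;> simp [hz]
  -- The range of 1_B on `Kpsi`, described as a set of fixed vectors so that closedness is
  -- immediate.
  let I : Submodule ℂ T.K :=
    T.Kpsi ψ n ⊓ (T.chi B hB - ContinuousLinearMap.id ℂ T.K).ker
  have hI : ∀ {x}, x ∈ I ↔ x ∈ T.Kpsi ψ n ∧ T.chi B hB x = x := fun {x} => by
    simp [I, sub_eq_zero]
  have hIcl : IsClosed (I : Set T.K) :=
    (Submodule.isClosed_topologicalClosure _).inter (ContinuousLinearMap.isClosed_ker _)
  have : CompleteSpace I := hIcl.completeSpace_coe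
  have hI1 : ∀ x ∈ I, T.Mz x ∈ I := fun x hx => by
    obtain ⟨hx1, hx2⟩ := hI.1 hx
    refine hI.2 ⟨?_, by rw [T.chi_Mz, hx2]⟩
    rw [← hx2]; exact hMz x hx1
  have hI2 : ∀ x ∈ I, T.Mzbar x ∈ I := fun x hx => by
    obtain ⟨hx1, hx2⟩ := hI.1 hx
    refine hI.2 ⟨?_, by rw [T.chi_Mzbar, hx2]⟩
    rw [← hx2]; exact hMzbar x hx1
  have hbot : I = ⊥ := by
    by_contra hne
    exact hpure I hI1 inf_le_left hne (T.isStarNormal_restrict I hI1 hI2)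
  refine T.measure_eq_zero_of_chi_H B hB fun x hx => ?_
  have : T.chi B hB x ∈ I := hI.2 ⟨hchi x (H_le_Kpsi ψ n hx), T.chi_chi B hB x⟩
  rwa [hbot, Submodule.mem_bot] at this

lemma ae_measure_singleton_eq_zero (T : SubnormalModel) : ∀ᵐ z : ℂ, T.μ 0 {z} = 0 := by
  have h : Set.Countable {z : ℂ | 0 < T.μ 0 {z}} :=
    Measure.countable_meas_pos_of_disjoint_iUnion (As := fun z : ℂ => {z})
      (fun z => measurableSet_singleton z) fun a b hab => by
        simpa [Function.onFun] using hab
  filter_upwards [h.ae_notMem volume] with z hz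
  simpa using hz

end SubnormalModel

end

theorem theorem3 (T : SubnormalModel) (N : ℕ) (hN : 1 < N) (ψ : ℂ → ℂ) (F : Fin N → T.H)
    (hT : T.HasProperty N ψ F) (G : ℕ → T.K)
    (hG : ∀ j, G j ∈ (T.Kpsi ψ (N - 1))ᗮ)
    (hdense : ((T.Kpsi ψ (N - 1))ᗮ : Set T.K) ⊆ closure (Set.range G)) :
    (T.μ 0).support ⊆ closure (⋃ k ∈ Finset.Icc 1 N, ⋃ j, T.E ψ F (G j) k) := by
  intro z hz
  by_contra hcl
  set B : Set ℂ := (closure (⋃ k ∈ Finset.Icc 1 N, ⋃ j, T.E ψ F (G j) k))ᶜ with hBdef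
  have hB : IsOpen B := isClosed_closure.isOpen_compl
  have hψ : ContDiff ℝ 1 ψ := hT.smooth.of_le (by norm_cast)
  have hψc := hT.compactSupport
  -- N > 1 makes the order N - 1 positive, where the kernel is bounded and the closure and
  -- continuity arguments apply.
  obtain ⟨M, hM⟩ : ∃ M, N - 1 = M + 1 := ⟨N - 2, by omega⟩
  have hdenseG : ∀ Y ∈ (T.Kpsi ψ (N - 1))ᗮ, ∀ i, ∀ w ∈ B, T.μ 0 {w} = 0 →
      genCauchy ψ (N - 1) (T.μ 0) (T.pairing (F i) Y) w = 0 := by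
    intro Y hY i w hw hwμ
    by_cases hwi : w ∈ interior (spectrum ℂ T.S)
    · rw [hM]
      refine T.genCauchy_succ_eq_zero_of_mem_closure hψ hψc M w (F i) ?_ (hdense hY)
      rintro _ ⟨j, rfl⟩
      rw [← hM]
      -- A nonzero value would put w in the closure that defines the complement of B.
      by_contra hne
      refine hw (closure_mono ?_
        (SubnormalModel.mem_closure_iUnion_E hN F (G j) i hwi hwμ hne))
      exact Set.iUnion₂_mono fun k _ => Set.subset_iUnion (fun j => T.E ψ F (G j) k) j
    · rw [hM]
      exact SubnormalModel.genCauchy_succ_eq_zero_of_notMem_interior hψ hψc hM.ge hwi hwμ (F i) hY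
  have hzero : T.μ 0 B = 0 := by
    refine SubnormalModel.measure_eq_zero_of_pairing_eq_zero hT.cyclic.1 hψ.continuous hψc
      hT.pure_Kpsi hB.measurableSet fun Y hY i => ?_
    refine SubnormalModel.ae_pairing_eq_zero hψ hψc hT.area (F i) hY hB ?_
    filter_upwards [T.ae_measure_singleton_eq_zero] with w hw hwB
    exact hdenseG Y hY i w hwB hw
  exact absurd hzero ((Measure.mem_support_iff_forall z).1 hz B (hB.mem_nhds hcl)).ne'
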